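/- Let $R$ be a commutative ring with unity (not necessarily noetherian) and let $C$ be a semidualizing $R$-module: $C$ has a resolution by finitely generated projective modules, the homothety map $R\to\operatorname{Hom}_R(C,C)$ is an isomorphism, and $\operatorname{Ext}^{i}_R(C,C)=0$ for all $i\geq 1$. A module is $C$-projective if it is isomorphic to $C\otimes_R P$ with $P$ projective. A module is $G_C$-projective if it is isomorphic to $\operatorname{Coker}(P_1\to P_0)$ for some exact sequence $X=\cdots\to P_1\to P_0\to C\otimes_R Q^0\to C\otimes_R Q^1\to\cdots$ with all $P_i,Q^i$ projective such that $\operatorname{Hom}_R(X,C\otimes_R Q)$ is exact for every projective $R$-module $Q$. For a class $\mathcal X$ of modules, an $\mathcal X$-resolution of $M$ is a complex $X=\cdots\to X_1\to X_0\to 0$ of modules in $\mathcal X$ together with a map $X_0\to M$ such that $\cdots\to X_1\to X_0\to M\to 0$ is exact; its length is $\sup\{n\mid X_n\neq 0\}$, and the $\mathcal X$-projective dimension of $M$ is the infimum of the lengths of its $\mathcal X$-resolutions (with $\sup\emptyset=-\infty$ and $\inf\emptyset=+\infty$; finite means $<+\infty$). **Theorem.** Let $M$ be an $R$-module of finite $G_C$-projective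 dimension $n$. Then $M$ has a $G_C$-projective resolution $X$ of length exactly $n$ which is strict, that is, its augmentation is an exact sequence $$0\to C\otimes_R P_n\to\cdots\to C\otimes_R P_1\to G\to M\to 0$$ with $G$ $G_C$-projective and $P_1,\dots,P_n$ projective. Moreover $X$ can be chosen so that 1. with $K=\operatorname{Ker}(G\to M)$, the exact sequence $0\to K\to G\to M\to 0$ is a $G_C$-projective approximation of $M$: $G$ is $G_C$-projective and $K$ has finite projective dimension with respect to the class of $C$-projective modules; 2. $X$ is a proper $G_C$-projective resolution: for every $G_C$-projective module $H$ the complex $$0\to\operatorname{Hom}_R(H,C\otimes_R P_n)\to\cdots\to\operatorname{Hom}_R(H,C\otimes_R P_1)\to\operatorname{Hom}_R(H,G)\to\operatorname{Hom}_R(H,M)\to 0$$ is exact. -/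

import Mathlib

open CategoryTheory
open scoped TensorProduct

universe u

noncomputable section

/-- An `𝒳`-resolution of the `R`-module `M`: a chain complex `⋯ ⟶ X₁ ⟶ X₀` of modules in the
class `𝒳` with an augmentation `X₀ ⟶ M` such that `⋯ ⟶ X₁ ⟶ X₀ ⟶ M ⟶ 0` is exact. -/
structure ClassResolution {R : Type u} [CommRing R] (𝒳 : ObjectProperty (ModuleCat.{u} R))
    (M : ModuleCat.{u} R) where
  /-- the underlying complex -/
  complex : ChainComplex (ModuleCat.{u} R) ℕ
  /-- the augmentation map -/
  aug : complex.X 0 ⟶ M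
  mem : ∀ i, 𝒳 (complex.X i)
  surjective_aug : Function.Surjective aug.hom
  exact_zero : Function.Exact (complex.d 1 0).hom aug.hom
  exact_succ : ∀ i, Function.Exact (complex.d (i + 2) (i + 1)).hom (complex.d (i + 1) i).hom

namespace ClassResolution

variable {R : Type u} [CommRing R] {𝒳 : ObjectProperty (ModuleCat.{u} R)} {M : ModuleCat.{u} R}

/-- `sup {n | Xₙ ≠ 0}`; it is `⊥` (i.e. `-∞`) for the zero complex and `⊤` if the complex is
not bounded. -/
def length (X : ClassResolution 𝒳 M) : WithBot ℕ∞ :=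
  sSup {k | ∃ n : ℕ, Nontrivial (X.complex.X n) ∧ k = ((n : ℕ∞) : WithBot ℕ∞)}

/-- The resolution is `𝒳`-proper: `Hom(Y, X⁺)` is exact for each `Y` in `𝒳`, where
`X⁺ = ⋯ ⟶ X₁ ⟶ X₀ ⟶ M ⟶ 0` is the augmented resolution. -/
def IsProper (X : ClassResolution 𝒳 M) : Prop :=
  ∀ Y : ModuleCat.{u} R, 𝒳 Y →
    Function.Surjective (fun f : Y →ₗ[R] X.complex.X 0 => X.aug.hom ∘ₗ f) ∧
    Function.Exact
      (fun f : Y →ₗ[R] X.complex.X 1 => (X.complex.d 1 0).hom ∘ₗ f)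
      (fun f : Y →ₗ[R] X.complex.X 0 => X.aug.hom ∘ₗ f) ∧
    ∀ i, Function.Exact
      (fun f : Y →ₗ[R] X.complex.X (i + 2) => (X.complex.d (i + 2) (i + 1)).hom ∘ₗ f)
      (fun f : Y →ₗ[R] X.complex.X (i + 1) => (X.complex.d (i + 1) i).hom ∘ₗ f)

end ClassResolution

/-- The `𝒳`-projective dimension `inf {sup {n | Xₙ ≠ 0} | X is an 𝒳-resolution of M}`;
it is `⊤` if there is no bounded resolution, and `⊥` for the zero module (if `0 ∈ 𝒳`). -/
def classProjDim {R : Type u} [CommRing R] (𝒳 : ObjectProperty (ModuleCat.{u} R))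
    (M : ModuleCat.{u} R) : WithBot ℕ∞ :=
  sInf {k | ∃ X : ClassResolution 𝒳 M, k = X.length}

/-- The class of finitely generated projective modules. -/
def finiteProjective (R : Type u) [CommRing R] : ObjectProperty (ModuleCat.{u} R) :=
  fun P => Module.Finite R P ∧ Module.Projective R P

/-- Semidualizing modules over a commutative ring (not necessarily noetherian). -/
structure IsSemidualizing {R : Type u} [CommRing R] (C : ModuleCat.{u} R) : Prop where
  /-- `C` admits a degreewise finite projective resolution -/
  exists_resolution : Nonempty (ClassResolution (finiteProjective R) C)
  /-- the homothety map `R → Hom(C, C)` is an isomorphism -/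
  homothety_bijective : Function.Bijective (LinearMap.lsmul R C)
  ext_vanishing : ∀ i : ℕ, 1 ≤ i → Subsingleton (Abelian.Ext C C i)

/-- The class `𝒫_C` of `C`-projective modules: those isomorphic to `C ⊗ P`, `P` projective. -/
def cProjective {R : Type u} [CommRing R] (C : ModuleCat.{u} R) :
    ObjectProperty (ModuleCat.{u} R) :=
  fun N => ∃ P : ModuleCat.{u} R, Module.Projective R P ∧ Nonempty (N ≃ₗ[R] C ⊗[R] P)

/-- A complete `PC`-resolution `⋯ ⟶ P₁ ⟶ P₀ ⟶ C ⊗ Q⁰ ⟶ C ⊗ Q¹ ⟶ ⋯`, where `Pᵢ` sits in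
degree `i ≥ 0` and `C ⊗ Qⁱ` sits in degree `-1 - i`. -/
structure IsCompletePCResolution {R : Type u} [CommRing R] (C : ModuleCat.{u} R)
    (X : ChainComplex (ModuleCat.{u} R) ℤ) : Prop where
  exact : ∀ i : ℤ, Function.Exact (X.d (i + 2) (i + 1)).hom (X.d (i + 1) i).hom
  projective : ∀ i : ℤ, 0 ≤ i → Module.Projective R (X.X i)
  cProjective : ∀ i : ℤ, i < 0 → cProjective C (X.X i)
  /-- `Hom(X, C ⊗ Q)` is exact for each projective `Q` -/
  hom_exact : ∀ Q : ModuleCat.{u} R, Module.Projective R Q → ∀ i : ℤ,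
    Function.Exact
      (fun f : X.X i →ₗ[R] C ⊗[R] Q => f ∘ₗ (X.d (i + 1) i).hom)
      (fun f : X.X (i + 1) →ₗ[R] C ⊗[R] Q => f ∘ₗ (X.d (i + 2) (i + 1)).hom)

/-- The class of `G_C`-projective modules: those isomorphic to `Coker (P₁ ⟶ P₀)` for some
complete `PC`-resolution. -/
def gcProjective {R : Type u} [CommRing R] (C : ModuleCat.{u} R) :
    ObjectProperty (ModuleCat.{u} R) :=
  fun M => ∃ X : ChainComplex (ModuleCat.{u} R) ℤ, IsCompletePCResolution C X ∧
    Nonempty (M ≃ₗ[R] (X.X 0 ⧸ LinearMap.range (X.d 1 0).hom))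

/-- A `G_C`-projective resolution is strict if it is bounded and `Xᵢ ≅ C ⊗ Pᵢ` with `Pᵢ`
projective for all `i ≥ 1`. -/
structure ClassResolution.IsStrict {R : Type u} [CommRing R] {C M : ModuleCat.{u} R}
    (X : ClassResolution (gcProjective C) M) : Prop where
  bounded : ∃ n : ℕ, ∀ i, n < i → Subsingleton (X.complex.X i)
  cProjective : ∀ i, 1 ≤ i → cProjective C (X.complex.X i)

/-- `0 ⟶ K ⟶ G ⟶ M ⟶ 0` is a `G_C`-projective approximation of `M`: it is exact, `G` is
`G_C`-projective and `K` has finite `𝒫_C`-projective dimension. -/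
structure IsGCApproximation {R : Type u} [CommRing R] (C : ModuleCat.{u} R)
    {K G M : ModuleCat.{u} R} (f : K ⟶ G) (g : G ⟶ M) : Prop where
  injective : Function.Injective f.hom
  exact : Function.Exact f.hom g.hom
  surjective : Function.Surjective g.hom
  gcProjective : gcProjective C G
  finite_dim : classProjDim (cProjective C) K < ⊤

end

/-!
The class of `G_C`-projective modules is described coinductively: it is the largest class of
modules `M` such that `Ext^i(M, C ⊗ Q) = 0` for all `i ≥ 1` and all projective `Q`, and such that
`M` embeds in a `C`-projective module with cokernel in the class
(`gcLargest_of_gcProjective`, `gcProjective_of_gcLargest`). To show that a module is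
`G_C`-projective it thus suffices to exhibit one class with these two properties which contains it.
This gives that `C`-projective modules are `G_C`-projective and that `G_C`-projective modules are
closed under extensions (`gcLargest_extension`). The input on `C` is that `Ext^i(L, C ⊗ Q) = 0` for
`i ≥ 1` and `L` `C`-projective (`IsSemidualizing.extVanishing`): since `C` has a degreewise finite
projective resolution, the vanishing of `Ext^i(C, C)` passes to direct sums of copies of `C` in the
second variable, and tensoring with a flat module preserves short exact sequences in the first.

A resolution of length `≤ n` is made strict by induction on `n` (`exists_isStrict`). Given
`0 ⟶ N ⟶ A ⟶ M ⟶ 0` with `A` `G_C`-projective, take a strict resolution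
`⋯ ⟶ C ⊗ P₁ ⟶ B ⟶ N ⟶ 0`, embed `B` in a `C`-projective module `E` with `G_C`-projective cokernel
`D`, and let `G` be the pushout of `A ⟵ B ⟶ E`. Then `G` is an extension of `D` by `A`, hence
`G_C`-projective, and `⋯ ⟶ C ⊗ P₁ ⟶ E ⟶ G ⟶ M ⟶ 0` is exact
(`exists_pushout_presentation`).

Every strict resolution is an approximation and is proper. Its kernels are finitely resolved by
`C`-projective modules, so `Ext¹(H, -)` vanishes on them for `H` `G_C`-projective, and this is
the obstruction to exactness of `Hom(H, -)` (`ClassResolution.IsStrict.isProper`).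
-/

/-! ### Vanishing of Ext -/

/-- `0 ⟶ A ⟶ B ⟶ D ⟶ 0` is exact. -/
structure IsShortExact {R : Type u} [CommRing R] {A B D : Type u}
    [AddCommGroup A] [AddCommGroup B] [AddCommGroup D] [Module R A] [Module R B] [Module R D]
    (f : A →ₗ[R] B) (g : B →ₗ[R] D) : Prop where
  injective : Function.Injective f
  exact : Function.Exact f g
  surjective : Function.Surjective g

/-- `Ext^i(M, N) = 0` for all `i ≥ 1`. -/
def ExtVanishing {R : Type u} [CommRing R] (M N : ModuleCat.{u} R) : Prop :=
  ∀ i : ℕ, Subsingleton (Abelian.Ext M N (i + 1))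

section Ext

variable {R : Type u} [CommRing R] {A B D : ModuleCat.{u} R} {f : A →ₗ[R] B} {g : B →ₗ[R] D}

theorem IsShortExact.exists_shortExact (h : IsShortExact f g) :
    ∃ w : ModuleCat.ofHom f ≫ ModuleCat.ofHom g = 0,
      (ShortComplex.mk (ModuleCat.ofHom f) (ModuleCat.ofHom g) w).ShortExact := by
  refine ⟨by ext x; exact h.exact.apply_apply_eq_zero x, ?_⟩
  exact ModuleCat.shortComplex_shortExact _ h.exact h.injective h.surjective

theorem ExtVanishing.of_projective (M N : ModuleCat.{u} R) [Module.Projective R M] :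
    ExtVanishing M N := fun _ => by
  have : Projective M := inferInstance
  exact Abelian.Ext.subsingleton_of_projective _ _ _

theorem ExtVanishing.of_subsingleton_right (M N : ModuleCat.{u} R) [Subsingleton N] :
    ExtVanishing M N := fun _ => by
  have h : Limits.IsZero N := ModuleCat.isZero_of_subsingleton N
  refine subsingleton_of_forall_eq 0 fun x => ?_
  have : x.comp (Abelian.Ext.mk₀ (𝟙 N)) (add_zero _) = x := by simp
  rw [← this, h.eq_of_src (𝟙 N) 0]
  simp

theorem ExtVanishing.of_retract {M M' : ModuleCat.{u} R} {N : ModuleCat.{u} R}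
    (h : ExtVanishing M' N) (s : M →ₗ[R] M') (r : M' →ₗ[R] M) (hrs : r ∘ₗ s = LinearMap.id) :
    ExtVanishing M N := fun i => by
  have := h i
  refine subsingleton_of_forall_eq 0 fun x => ?_
  have h1 : (Abelian.Ext.mk₀ (ModuleCat.ofHom s)).comp
      ((Abelian.Ext.mk₀ (ModuleCat.ofHom r)).comp x (zero_add _)) (zero_add _) = x := by
    rw [Abelian.Ext.mk₀_comp_mk₀_assoc, ← ModuleCat.ofHom_comp, hrs]
    exact Abelian.Ext.mk₀_id_comp x
  rw [← h1, Subsingleton.elim ((Abelian.Ext.mk₀ (ModuleCat.ofHom r)).comp x (zero_add _)) 0]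
  simp

theorem ExtVanishing.of_equiv {M M' : ModuleCat.{u} R} {N : ModuleCat.{u} R}
    (h : ExtVanishing M' N) (e : M ≃ₗ[R] M') : ExtVanishing M N :=
  h.of_retract e.toLinearMap e.symm.toLinearMap (by ext; simp)

theorem ExtVanishing.of_equiv_right {M N N' : ModuleCat.{u} R} (h : ExtVanishing M N')
    (e : N ≃ₗ[R] N') : ExtVanishing M N := fun i => by
  have := h i
  refine subsingleton_of_forall_eq 0 fun x => ?_
  have h1 : (x.comp (Abelian.Ext.mk₀ (ModuleCat.ofHom e.toLinearMap)) (add_zero _)).comp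
      (Abelian.Ext.mk₀ (ModuleCat.ofHom e.symm.toLinearMap)) (add_zero _) = x := by
    rw [Abelian.Ext.comp_assoc_of_third_deg_zero, Abelian.Ext.mk₀_comp_mk₀,
      ← ModuleCat.ofHom_comp]
    simp
  rw [← h1, Subsingleton.elim
    (x.comp (Abelian.Ext.mk₀ (ModuleCat.ofHom e.toLinearMap)) (add_zero _)) 0]
  simp

namespace IsShortExact

theorem extVanishing_middle (h : IsShortExact f g) {N : ModuleCat.{u} R} (hA : ExtVanishing A N)
    (hD : ExtVanishing D N) : ExtVanishing B N := fun i => by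
  obtain ⟨w, hS⟩ := h.exists_shortExact
  have := hA i
  have := hD i
  refine subsingleton_of_forall_eq 0 fun x => ?_
  obtain ⟨y, rfl⟩ := Abelian.Ext.contravariant_sequence_exact₂ hS N x
    (Subsingleton.elim (α := Abelian.Ext A N (i + 1)) _ _)
  rw [Subsingleton.elim (α := Abelian.Ext D N (i + 1)) y 0]
  simp

theorem extVanishing_left (h : IsShortExact f g) {N : ModuleCat.{u} R} (hB : ExtVanishing B N)
    (hD : ExtVanishing D N) : ExtVanishing A N := fun i => by
  obtain ⟨w, hS⟩ := h.exists_shortExact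
  have := hB i
  have := hD (i + 1)
  refine subsingleton_of_forall_eq 0 fun x => ?_
  obtain ⟨y, rfl⟩ := Abelian.Ext.contravariant_sequence_exact₁ hS N x (n₁ := i + 1 + 1) (by omega)
    (Subsingleton.elim (α := Abelian.Ext D N (i + 1 + 1)) _ _)
  rw [Subsingleton.elim (α := Abelian.Ext B N (i + 1)) y 0]
  simp

theorem subsingleton_ext_succ (h : IsShortExact f g) {N : ModuleCat.{u} R}
    (hB : ExtVanishing B N) (i : ℕ) (hA : Subsingleton (Abelian.Ext A N (i + 1))) :
    Subsingleton (Abelian.Ext D N (i + 1 + 1)) := by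
  obtain ⟨w, hS⟩ := h.exists_shortExact
  have := hB (i + 1)
  refine subsingleton_of_forall_eq 0 fun x => ?_
  obtain ⟨y, rfl⟩ := Abelian.Ext.contravariant_sequence_exact₃ hS N x
    (Subsingleton.elim (α := Abelian.Ext B N (i + 1 + 1)) _ _) (n₀ := i + 1) (by omega)
  rw [Subsingleton.elim (α := Abelian.Ext A N (i + 1)) y 0]
  simp

theorem subsingleton_ext_one (h : IsShortExact f g) {N : ModuleCat.{u} R}
    (hB : ExtVanishing B N) (hext : ∀ a : A →ₗ[R] N, ∃ b : B →ₗ[R] N, b ∘ₗ f = a) :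
    Subsingleton (Abelian.Ext D N 1) := by
  obtain ⟨w, hS⟩ := h.exists_shortExact
  have := hB 0
  refine subsingleton_of_forall_eq 0 fun x => ?_
  obtain ⟨y, rfl⟩ := Abelian.Ext.contravariant_sequence_exact₃ hS N x
    (Subsingleton.elim (α := Abelian.Ext B N 1) _ _) (n₀ := 0) (by omega)
  obtain ⟨a, rfl⟩ := Abelian.Ext.addEquiv₀.symm.surjective y
  obtain ⟨b, hb⟩ := hext a.hom
  have : a = ModuleCat.ofHom f ≫ ModuleCat.ofHom b := by
    ext1; exact hb.symm
  subst this
  rw [Abelian.Ext.addEquiv₀_symm_apply, ← Abelian.Ext.mk₀_comp_mk₀]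
  exact hS.extClass_comp_assoc _

theorem exists_extension (h : IsShortExact f g) {N : ModuleCat.{u} R}
    (hD : ExtVanishing D N) (a : A →ₗ[R] N) : ∃ b : B →ₗ[R] N, b ∘ₗ f = a := by
  obtain ⟨w, hS⟩ := h.exists_shortExact
  have := hD 0
  obtain ⟨y, hy⟩ := Abelian.Ext.contravariant_sequence_exact₁ hS N
    (Abelian.Ext.mk₀ (ModuleCat.ofHom a)) (n₁ := 1) (by omega)
    (Subsingleton.elim (α := Abelian.Ext D N 1) _ _)
  obtain ⟨b, rfl⟩ := Abelian.Ext.addEquiv₀.symm.surjective y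
  rw [Abelian.Ext.addEquiv₀_symm_apply, Abelian.Ext.mk₀_comp_mk₀] at hy
  have := Abelian.Ext.addEquiv₀.symm.injective hy
  exact ⟨b.hom, congrArg ModuleCat.Hom.hom this⟩

theorem extVanishing_right_of_covariant (h : IsShortExact f g) {H : ModuleCat.{u} R}
    (hA : ExtVanishing H A) (hB : ExtVanishing H B) : ExtVanishing H D := fun i => by
  obtain ⟨w, hS⟩ := h.exists_shortExact
  have := hA (i + 1)
  have := hB i
  refine subsingleton_of_forall_eq 0 fun x => ?_
  obtain ⟨y, rfl⟩ := Abelian.Ext.covariant_sequence_exact₃ H hS x (n₁ := i + 1 + 1) rfl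
    (Subsingleton.elim (α := Abelian.Ext H A (i + 1 + 1)) _ _)
  rw [Subsingleton.elim (α := Abelian.Ext H B (i + 1)) y 0]
  simp

theorem exists_lift (h : IsShortExact f g) {H : ModuleCat.{u} R}
    (hA : ExtVanishing H A) (d : H →ₗ[R] D) : ∃ b : H →ₗ[R] B, g ∘ₗ b = d := by
  obtain ⟨w, hS⟩ := h.exists_shortExact
  have := hA 0
  obtain ⟨y, hy⟩ := Abelian.Ext.covariant_sequence_exact₃ H hS
    (Abelian.Ext.mk₀ (ModuleCat.ofHom d)) (n₁ := 1) (by omega)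
    (Subsingleton.elim (α := Abelian.Ext H A 1) _ _)
  obtain ⟨b, rfl⟩ := Abelian.Ext.addEquiv₀.symm.surjective y
  rw [Abelian.Ext.addEquiv₀_symm_apply, Abelian.Ext.mk₀_comp_mk₀] at hy
  have := Abelian.Ext.addEquiv₀.symm.injective hy
  exact ⟨b.hom, congrArg ModuleCat.Hom.hom this⟩

end IsShortExact

theorem isShortExact_ker_subtype {A B : Type u} [AddCommGroup A] [AddCommGroup B] [Module R A]
    [Module R B] {g : A →ₗ[R] B} (hg : Function.Surjective g) :
    IsShortExact (LinearMap.ker g).subtype g :=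
  ⟨Subtype.val_injective, LinearMap.exact_subtype_ker_map g, hg⟩

/-- Dimension shifting. If each member `Z` of a class has a presentation
`0 ⟶ Z' ⟶ X ⟶ Z ⟶ 0` such that `Z'` is in the class, `Ext^i(X, N) = 0` for `i ≥ 1`, and every
map `Z' ⟶ N` extends to `X`, then `Ext^i(Z, N) = 0` for `i ≥ 1` and all `Z` in the class. -/
theorem ExtVanishing.of_dimension_shift {N : ModuleCat.{u} R}
    (𝒮 : ObjectProperty (ModuleCat.{u} R))
    (H : ∀ Z, 𝒮 Z → ∃ (Z' X : ModuleCat.{u} R) (f : Z' →ₗ[R] X) (g : X →ₗ[R] Z),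
      IsShortExact f g ∧ 𝒮 Z' ∧ ExtVanishing X N ∧
        ∀ a : Z' →ₗ[R] N, ∃ b : X →ₗ[R] N, b ∘ₗ f = a)
    {Z : ModuleCat.{u} R} (hZ : 𝒮 Z) : ExtVanishing Z N := by
  intro i
  induction i generalizing Z with
  | zero =>
    obtain ⟨Z', X, f, g, h, -, hX, hext⟩ := H Z hZ
    exact h.subsingleton_ext_one hX hext
  | succ i ih =>
    obtain ⟨Z', X, f, g, h, hZ', hX, -⟩ := H Z hZ
    exact h.subsingleton_ext_succ hX i (ih hZ')

end Ext

/-! ### Shifting and prolonging resolutions -/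

section Resolutions

variable {R : Type u} [CommRing R] {𝒳 𝒴 : ObjectProperty (ModuleCat.{u} R)}
  {M : ModuleCat.{u} R}

/-- Deleting the degree zero term of a resolution `⋯ ⟶ X₁ ⟶ X₀ ⟶ M` leaves a resolution
of `Ker (X₀ ⟶ M)`. -/
noncomputable def ClassResolution.ker (X : ClassResolution 𝒳 M)
    (h : ∀ i, 𝒴 (X.complex.X (i + 1))) :
    ClassResolution 𝒴 (ModuleCat.of R (LinearMap.ker X.aug.hom)) where
  complex := ChainComplex.truncate.obj X.complex
  aug := ModuleCat.ofHom ((X.complex.d 1 0).hom.codRestrict (LinearMap.ker X.aug.hom)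
    fun x => X.exact_zero.apply_apply_eq_zero x)
  mem := h
  surjective_aug := by
    rintro ⟨y, hy⟩
    obtain ⟨x, hx⟩ := (X.exact_zero y).1 hy
    exact ⟨x, Subtype.ext hx⟩
  exact_zero := fun y => by
    refine Iff.trans ?_ (X.exact_succ 0 y)
    exact Subtype.ext_iff
  exact_succ := fun i => X.exact_succ (i + 1)

/-- A resolution of `K` and a short exact sequence `0 ⟶ K ⟶ G ⟶ M ⟶ 0` splice to a resolution
of `M` with `G` in degree zero. -/
noncomputable def ClassResolution.splice {K G : ModuleCat.{u} R} (X : ClassResolution 𝒳 K)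
    (h𝒳 : ∀ i, 𝒴 (X.complex.X i)) (hG : 𝒴 G) {f : K →ₗ[R] G} {g : G →ₗ[R] M}
    (h : IsShortExact f g) : ClassResolution 𝒴 M where
  complex := ChainComplex.augment X.complex (X.aug ≫ ModuleCat.ofHom f) (by
    ext x
    exact (congrArg f (X.exact_zero.apply_apply_eq_zero x)).trans (map_zero f))
  aug := ModuleCat.ofHom g
  mem
    | 0 => hG
    | i + 1 => h𝒳 i
  surjective_aug := h.surjective
  exact_zero := fun y => by
    rw [ChainComplex.augment_d_one_zero]
    refine (h.exact y).trans ⟨?_, ?_⟩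
    · rintro ⟨k, rfl⟩
      obtain ⟨x, rfl⟩ := X.surjective_aug k
      exact ⟨x, rfl⟩
    · rintro ⟨x, rfl⟩
      exact ⟨X.aug.hom x, rfl⟩
  exact_succ
    | 0 => fun y => by
      refine Iff.trans ?_ (X.exact_zero y)
      exact map_eq_zero_iff f h.injective
    | i + 1 => X.exact_succ i

theorem ClassResolution.length_le (X : ClassResolution 𝒳 M) {k : WithBot ℕ∞}
    (h : ∀ n : ℕ, Nontrivial (X.complex.X n) → ((n : ℕ∞) : WithBot ℕ∞) ≤ k) : X.length ≤ k := by
  refine sSup_le ?_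
  rintro _ ⟨n, hn, rfl⟩
  exact h n hn

theorem ClassResolution.le_length (X : ClassResolution 𝒳 M) (n : ℕ)
    (h : Nontrivial (X.complex.X n)) : ((n : ℕ∞) : WithBot ℕ∞) ≤ X.length :=
  le_sSup ⟨n, h, rfl⟩

theorem ClassResolution.length_lt_top (X : ClassResolution 𝒳 M) {n : ℕ}
    (h : ∀ i, n ≤ i → Subsingleton (X.complex.X i)) : X.length < ⊤ := by
  have h1 : X.length ≤ ((n : ℕ∞) : WithBot ℕ∞) := X.length_le fun i hi => by
    have : i < n := by
      by_contra hni
      exact not_subsingleton_iff_nontrivial.2 hi (h i (by omega))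
    exact_mod_cast this.le
  refine h1.trans_lt ?_
  rw [← WithBot.coe_top, WithBot.coe_lt_coe]
  exact ENat.natCast_lt_top n

theorem classProjDim_le (X : ClassResolution 𝒳 M) : classProjDim 𝒳 M ≤ X.length :=
  sInf_le ⟨X, rfl⟩

/-- A finite `𝒳`-projective dimension is attained. -/
theorem exists_length_eq_classProjDim (h : classProjDim 𝒳 M < ⊤) :
    ∃ X : ClassResolution 𝒳 M, X.length = classProjDim 𝒳 M := by
  have hne : {k | ∃ X : ClassResolution 𝒳 M, k = X.length}.Nonempty := by
    by_contra hemp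
    rw [Set.not_nonempty_iff_eq_empty] at hemp
    rw [classProjDim, hemp, sInf_empty] at h
    exact lt_irrefl _ h
  obtain ⟨X, hX⟩ := csInf_mem hne
  exact ⟨X, hX.symm⟩

end Resolutions

/-! ### Ext between `C`-projective modules -/

section CProjective

variable {R : Type u} [CommRing R]

/-- For finitely generated `A`, extendability of maps along `f : A ⟶ B` passes from a target `C` to
direct sums of copies of `C`, since a map from `A` to a direct sum has finitely many
nonzero components. -/
theorem exists_extension_finsupp {A B C : Type u} [AddCommGroup A] [AddCommGroup B]
    [AddCommGroup C] [Module R A] [Module R B] [Module R C] [Module.Finite R A] (f : A →ₗ[R] B)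
    (hf : ∀ a : A →ₗ[R] C, ∃ b : B →ₗ[R] C, b ∘ₗ f = a) (I : Type u) (a : A →ₗ[R] (I →₀ C)) :
    ∃ b : B →ₗ[R] (I →₀ C), b ∘ₗ f = a := by
  classical
  choose b hb using fun i => hf (Finsupp.lapply i ∘ₗ a)
  obtain ⟨S, hS⟩ := Module.Finite.fg_top (R := R) (M := A)
  let s : Finset I := S.biUnion fun x => (a x).support
  have hs : ∀ x, (a x).support ⊆ s := by
    have : (⊤ : Submodule R A) ≤ (Finsupp.supported C R (s : Set I)).comap a := by
      rw [← hS, Submodule.span_le]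
      intro x hx
      simp only [Submodule.comap_coe, Set.mem_preimage, SetLike.mem_coe, Finsupp.mem_supported,
        Finset.coe_subset]
      exact Finset.subset_biUnion_of_mem (fun x => (a x).support) hx
    intro x
    have := this (Submodule.mem_top (x := x))
    simpa [Finsupp.mem_supported] using this
  refine ⟨∑ i ∈ s, Finsupp.lsingle i ∘ₗ b i, ?_⟩
  ext1 x
  have hbx : ∀ i, b i (f x) = a x i := fun i => LinearMap.congr_fun (hb i) x
  simp only [LinearMap.coe_comp, Function.comp_apply, LinearMap.sum_apply, hbx,
    Finsupp.lsingle_apply]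
  rw [← Finsupp.sum_of_support_subset (a x) (hs x) (fun i c => Finsupp.single i c) (by simp)]
  exact Finsupp.sum_single _

theorem exists_extension_tensor {A B C Q : Type u} [AddCommGroup A] [AddCommGroup B]
    [AddCommGroup C] [AddCommGroup Q] [Module R A] [Module R B] [Module R C] [Module R Q]
    [Module.Finite R A] [Module.Projective R Q] (f : A →ₗ[R] B)
    (hf : ∀ a : A →ₗ[R] C, ∃ b : B →ₗ[R] C, b ∘ₗ f = a) (a : A →ₗ[R] C ⊗[R] Q) :
    ∃ b : B →ₗ[R] C ⊗[R] Q, b ∘ₗ f = a := by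
  classical
  obtain ⟨s, hs⟩ := (Module.projective_def' (R := R) (P := Q)).1 inferInstance
  let e := TensorProduct.finsuppScalarRight R R C Q
  obtain ⟨b, hb⟩ := exists_extension_finsupp f hf Q (e.toLinearMap ∘ₗ s.lTensor C ∘ₗ a)
  refine ⟨(Finsupp.linearCombination R id).lTensor C ∘ₗ e.symm.toLinearMap ∘ₗ b, ?_⟩
  rw [LinearMap.comp_assoc, LinearMap.comp_assoc, hb]
  ext x
  simp only [LinearMap.coe_comp, LinearEquiv.coe_coe, Function.comp_apply,
    LinearEquiv.symm_apply_apply]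
  rw [← LinearMap.lTensor_comp_apply, hs]
  simp

/-- If `Ext^i(Z, C) = 0` for `i ≥ 1` then also `Ext^i(Z, C ⊗ Q) = 0` for projective `Q`: all
syzygies of `Z` are finitely generated, so `exists_extension_tensor` allows dimension shifting. -/
theorem ExtVanishing.tensor_right {Z C : ModuleCat.{u} R}
    (hZ : Nonempty (ClassResolution (finiteProjective R) Z)) (h : ExtVanishing Z C)
    (Q : ModuleCat.{u} R) [Module.Projective R Q] :
    ExtVanishing Z (ModuleCat.of R (C ⊗[R] Q)) := by
  refine ExtVanishing.of_dimension_shift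
    (fun Z => Nonempty (ClassResolution (finiteProjective R) Z) ∧ ExtVanishing Z C) ?_ ⟨hZ, h⟩
  rintro Z ⟨⟨X⟩, h⟩
  have hses := isShortExact_ker_subtype X.surjective_aug
  let X' := X.ker (𝒴 := finiteProjective R) fun i => X.mem (i + 1)
  have := (X.mem 0).2
  have := (X'.mem 0).1
  have : Module.Finite R (LinearMap.ker X.aug.hom) :=
    Module.Finite.of_surjective X'.aug.hom X'.surjective_aug
  refine ⟨ModuleCat.of R (LinearMap.ker X.aug.hom), X.complex.X 0, _, _, hses, ⟨⟨X'⟩, ?_⟩,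
    .of_projective _ _, ?_⟩
  · exact hses.extVanishing_left (A := ModuleCat.of R (LinearMap.ker X.aug.hom))
      (.of_projective _ _) h
  · exact exists_extension_tensor _
      (hses.exists_extension (A := ModuleCat.of R (LinearMap.ker X.aug.hom)) h)

theorem exists_projective_presentation (M : ModuleCat.{u} R) :
    ∃ (K F : ModuleCat.{u} R) (f : K →ₗ[R] F) (g : F →ₗ[R] M),
      Module.Projective R F ∧ IsShortExact f g :=
  ⟨ModuleCat.of R (LinearMap.ker (Finsupp.linearCombination R (id : M → M))),
    ModuleCat.of R (M →₀ R), _, _, inferInstanceAs (Module.Projective R (M →₀ R)),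
    isShortExact_ker_subtype (Finsupp.linearCombination_id_surjective R M)⟩

theorem IsShortExact.rTensor {A B D : Type u} [AddCommGroup A] [AddCommGroup B] [AddCommGroup D]
    [Module R A] [Module R B] [Module R D] {f : A →ₗ[R] B} {g : B →ₗ[R] D} (h : IsShortExact f g)
    (P : Type u) [AddCommGroup P] [Module R P] [Module.Flat R P] :
    IsShortExact (f.rTensor P) (g.rTensor P) :=
  ⟨Module.Flat.rTensor_preserves_injective_linearMap _ h.injective,
    rTensor_exact P h.exact h.surjective, LinearMap.rTensor_surjective P h.surjective⟩

/-- Under adjunction, extending `A ⊗ P ⟶ N` along `f ⊗ P` is lifting a map from the projective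
`P` along `Hom(B, N) ⟶ Hom(A, N)`. -/
theorem exists_extension_rTensor {A B N P : Type u} [AddCommGroup A] [AddCommGroup B]
    [AddCommGroup N] [AddCommGroup P] [Module R A] [Module R B] [Module R N] [Module R P]
    [Module.Projective R P] (f : A →ₗ[R] B)
    (hf : ∀ a : A →ₗ[R] N, ∃ b : B →ₗ[R] N, b ∘ₗ f = a) (a : A ⊗[R] P →ₗ[R] N) :
    ∃ b : B ⊗[R] P →ₗ[R] N, b ∘ₗ f.rTensor P = a := by
  have hres : Function.Surjective (LinearMap.lcomp R N f) := hf
  obtain ⟨b, hb⟩ := Module.projective_lifting_property (LinearMap.lcomp R N f)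
    ((TensorProduct.mk R A P).compr₂ a).flip hres
  refine ⟨TensorProduct.lift b.flip, ?_⟩
  ext k x
  exact LinearMap.congr_fun (LinearMap.congr_fun hb x) k

theorem ExtVanishing.tensor_left {Z N : ModuleCat.{u} R} (h : ExtVanishing Z N)
    (P : ModuleCat.{u} R) [Module.Projective R P] :
    ExtVanishing (ModuleCat.of R (Z ⊗[R] P)) N := by
  refine ExtVanishing.of_dimension_shift
    (fun W => ∃ Z : ModuleCat.{u} R, ExtVanishing Z N ∧ W = ModuleCat.of R (Z ⊗[R] P)) ?_
    ⟨Z, h, rfl⟩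
  rintro _ ⟨Z, h, rfl⟩
  obtain ⟨K, F, f, g, hF, hses⟩ := exists_projective_presentation Z
  exact ⟨ModuleCat.of R (K ⊗[R] P), ModuleCat.of R (F ⊗[R] P), _, _, hses.rTensor P,
    ⟨K, hses.extVanishing_left (.of_projective _ _) h, rfl⟩, .of_projective _ _,
    exists_extension_rTensor _ (hses.exists_extension h)⟩

/-- For `C` semidualizing, `Ext^i(C ⊗ P, C ⊗ Q) = 0` for `i ≥ 1` and `P`, `Q` projective. -/
theorem IsSemidualizing.extVanishing {C : ModuleCat.{u} R} (hC : IsSemidualizing C)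
    {L : ModuleCat.{u} R} (hL : cProjective C L) (Q : ModuleCat.{u} R) [Module.Projective R Q] :
    ExtVanishing L (ModuleCat.of R (C ⊗[R] Q)) := by
  obtain ⟨P, hP, ⟨e⟩⟩ := hL
  have h : ExtVanishing C C := fun i => hC.ext_vanishing (i + 1) (by omega)
  exact ((h.tensor_right hC.exists_resolution Q).tensor_left P).of_equiv
    (M' := ModuleCat.of R (C ⊗[R] P)) e

theorem cProjective_of_subsingleton (C : ModuleCat.{u} R) (L : ModuleCat.{u} R) [Subsingleton L] :
    cProjective C L := by
  refine ⟨ModuleCat.of R PUnit, inferInstanceAs (Module.Projective R PUnit.{u + 1}), ⟨?_⟩⟩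
  have : Subsingleton (C ⊗[R] (ModuleCat.of R PUnit.{u + 1})) :=
    inferInstanceAs (Subsingleton (C ⊗[R] PUnit.{u + 1}))
  exact LinearEquiv.ofSubsingleton _ _

theorem cProjective_prod {C L L' : ModuleCat.{u} R} (hL : cProjective C L)
    (hL' : cProjective C L') : cProjective C (ModuleCat.of R (L × L')) := by
  obtain ⟨P, hP, ⟨e⟩⟩ := hL
  obtain ⟨P', hP', ⟨e'⟩⟩ := hL'
  exact ⟨ModuleCat.of R (P × P'), inferInstanceAs (Module.Projective R (P × P')),
    ⟨(e.prodCongr e').trans (TensorProduct.prodRight R R C P P').symm⟩⟩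

end CProjective

/-! ### A coinductive description of `G_C`-projective modules -/

/-- A class of modules which is stable under the coinductive description of `G_C`-projectivity:
each member `M` satisfies `Ext^i(M, C ⊗ Q) = 0` for `i ≥ 1` and `Q` projective, and embeds in a
`C`-projective module with cokernel in the class. -/
structure IsGCStable {R : Type u} [CommRing R] (C : ModuleCat.{u} R)
    (𝒲 : ObjectProperty (ModuleCat.{u} R)) : Prop where
  extVanishing : ∀ M, 𝒲 M → ∀ Q : ModuleCat.{u} R, Module.Projective R Q →
    ExtVanishing M (ModuleCat.of R (C ⊗[R] Q))
  exists_embedding : ∀ M, 𝒲 M → ∃ (E N : ModuleCat.{u} R) (f : M →ₗ[R] E) (g : E →ₗ[R] N),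
    cProjective C E ∧ 𝒲 N ∧ IsShortExact f g

/-- The largest class satisfying `IsGCStable C`, as the union of all such classes. -/
def gcLargest {R : Type u} [CommRing R] (C : ModuleCat.{u} R) : ObjectProperty (ModuleCat.{u} R) :=
  fun M => ∃ 𝒲, IsGCStable C 𝒲 ∧ 𝒲 M

section

variable {R : Type u} [CommRing R] {C : ModuleCat.{u} R}

theorem isGCStable_gcLargest (C : ModuleCat.{u} R) : IsGCStable C (gcLargest C) where
  extVanishing := fun M ⟨_, h𝒲, hM⟩ => h𝒲.extVanishing M hM
  exists_embedding := fun M ⟨𝒲, h𝒲, hM⟩ => by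
    obtain ⟨E, N, f, g, hE, hN, h⟩ := h𝒲.exists_embedding M hM
    exact ⟨E, N, f, g, hE, ⟨𝒲, h𝒲, hN⟩, h⟩

theorem IsShortExact.exists_factor {A B D N : Type u} [AddCommGroup A] [AddCommGroup B]
    [AddCommGroup D] [AddCommGroup N] [Module R A] [Module R B] [Module R D] [Module R N]
    {f : A →ₗ[R] B} {g : B →ₗ[R] D} (h : IsShortExact f g) (φ : B →ₗ[R] N)
    (hφ : φ ∘ₗ f = 0) : ∃ ψ : D →ₗ[R] N, ψ ∘ₗ g = φ := by
  have hk : LinearMap.ker g ≤ LinearMap.ker φ := fun x hx => by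
    obtain ⟨a, rfl⟩ := (h.exact x).1 hx
    exact LinearMap.congr_fun hφ a
  let e := g.quotKerEquivOfSurjective h.surjective
  refine ⟨(LinearMap.ker g).liftQ φ hk ∘ₗ e.symm.toLinearMap, ?_⟩
  ext x
  have : e.symm (g x) = (LinearMap.ker g).mkQ x := by
    rw [LinearEquiv.symm_apply_eq]
    exact (g.quotKerEquivOfSurjective_apply_mk h.surjective x).symm
  simp [this]

/-- The short exact sequence `0 ⟶ Coker f ⟶ D ⟶ Coker g ⟶ 0` of an exact `A ⟶ B ⟶ D`; it links
consecutive syzygies of an acyclic complex. -/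
theorem isShortExact_coker {A B D : Type u} [AddCommGroup A] [AddCommGroup B]
    [AddCommGroup D] [Module R A] [Module R B] [Module R D]
    {f : A →ₗ[R] B} {g : B →ₗ[R] D} (h : Function.Exact f g) :
    IsShortExact ((LinearMap.range f).liftQ g (by
      rw [LinearMap.exact_iff.1 h])) (LinearMap.range g).mkQ where
  injective := by
    rw [← LinearMap.ker_eq_bot, Submodule.ker_liftQ, LinearMap.exact_iff.1 h]
    simp
  exact := by
    rw [LinearMap.exact_iff, Submodule.ker_mkQ, Submodule.range_liftQ]
  surjective := Submodule.mkQ_surjective _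

/-- The cokernels to the right of the middle of a complete `PC`-resolution form a stable class. -/
theorem gcLargest_of_gcProjective (hC : IsSemidualizing C) {M : ModuleCat.{u} R}
    (hM : gcProjective C M) : gcLargest C M := by
  obtain ⟨X, hX, ⟨e⟩⟩ := hM
  let Z : ℤ → ModuleCat.{u} R := fun i =>
    ModuleCat.of R (X.X i ⧸ LinearMap.range (X.d (i + 1) i).hom)
  have hex : ∀ i, Function.Exact (X.d (i + 1 + 1) (i + 1)).hom (X.d (i + 1) i).hom := fun i => by
    have := hX.exact i
    rwa [show i + 2 = i + 1 + 1 by ring] at this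
  have hses : ∀ i, ∃ (f : Z (i + 1) →ₗ[R] X.X i) (g : X.X i →ₗ[R] Z i), IsShortExact f g ∧
      f ∘ₗ (LinearMap.range (X.d (i + 1 + 1) (i + 1)).hom).mkQ = (X.d (i + 1) i).hom :=
    fun i => ⟨_, _, isShortExact_coker (hex i), Submodule.liftQ_mkQ _ _ _⟩
  have hXi : ∀ (Q : ModuleCat.{u} R), Module.Projective R Q → ∀ i,
      ExtVanishing (X.X i) (ModuleCat.of R (C ⊗[R] Q)) := fun Q hQ i => by
    rcases le_or_gt 0 i with hi | hi
    · have := hX.projective i hi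
      exact .of_projective _ _
    · exact hC.extVanishing (hX.cProjective i hi) Q
  have hZ : ∀ (Q : ModuleCat.{u} R), Module.Projective R Q → ∀ i,
      ExtVanishing (Z i) (ModuleCat.of R (C ⊗[R] Q)) := fun Q hQ i => by
    refine ExtVanishing.of_dimension_shift (fun W => ∃ i, W = Z i) ?_ ⟨i, rfl⟩
    rintro _ ⟨i, rfl⟩
    obtain ⟨f, g, h, hf⟩ := hses i
    refine ⟨Z (i + 1), X.X i, f, g, h, ⟨_, rfl⟩, hXi Q hQ i, fun a => ?_⟩
    have hQi := hX.hom_exact Q hQ i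
    rw [show i + 2 = i + 1 + 1 by ring] at hQi
    obtain ⟨b, hb⟩ := (hQi (a ∘ₗ (LinearMap.range (X.d (i + 1 + 1) (i + 1)).hom).mkQ)).1 (by
      ext x
      exact (congrArg a ((Submodule.Quotient.mk_eq_zero _).2 ⟨x, rfl⟩)).trans (map_zero a))
    refine ⟨b, ?_⟩
    refine LinearMap.ext fun z => ?_
    obtain ⟨x, rfl⟩ := Submodule.mkQ_surjective _ z
    have h1 := LinearMap.congr_fun hb x
    have h2 := LinearMap.congr_fun hf x
    exact (congrArg b h2).trans h1
  refine ⟨fun W => ∃ i ≤ 0, Nonempty (W ≃ₗ[R] Z i), ⟨?_, ?_⟩, 0, le_rfl, ⟨e⟩⟩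
  · rintro W ⟨i, -, ⟨e⟩⟩ Q hQ
    exact (hZ Q hQ i).of_equiv e
  · rintro W ⟨i, hi, ⟨e⟩⟩
    obtain ⟨j, rfl⟩ : ∃ j, i = j + 1 := ⟨i - 1, by ring⟩
    obtain ⟨f, g, h, -⟩ := hses j
    refine ⟨X.X j, Z j, f ∘ₗ e.toLinearMap, g, hX.cProjective j (by omega),
      ⟨j, by omega, ⟨LinearEquiv.refl R _⟩⟩, ⟨h.injective.comp e.injective, fun x => ?_,
      h.surjective⟩⟩
    refine (h.exact x).trans ⟨?_, ?_⟩
    · rintro ⟨y, rfl⟩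
      exact ⟨e.symm y, by simp⟩
    · rintro ⟨y, rfl⟩
      exact ⟨e y, rfl⟩

theorem exists_seq_of_step {T : Type*} {S : T → Prop} {r : T → T → Prop}
    (h : ∀ a, S a → ∃ b, S b ∧ r a b) {a : T} (ha : S a) :
    ∃ f : ℕ → T, f 0 = a ∧ ∀ n, S (f n) ∧ r (f n) (f (n + 1)) := by
  choose F hF using fun x : {a // S a} => h x.1 x.2
  let f : ℕ → {a // S a} := fun n => Nat.rec ⟨a, ha⟩ (fun _ x => ⟨F x, (hF x).1⟩) n
  exact ⟨fun n => (f n).1, rfl, fun n => ⟨(f n).2, (hF (f n)).2⟩⟩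

/-- Splicing a sequence of steps to the left of `a` and one to the right of `a` into a sequence
indexed by `ℤ`. -/
theorem exists_int_seq_of_step {T : Type*} {S S' : T → Prop} {r r' : T → T → Prop}
    (h : ∀ a, S a → ∃ b, S b ∧ r a b) (h' : ∀ a, S' a → ∃ b, S' b ∧ r' a b) {a : T}
    (ha : S a) (ha' : S' a) :
    ∃ f : ℤ → T, f 0 = a ∧ (∀ i, 0 ≤ i → S (f i) ∧ r (f i) (f (i + 1))) ∧
      ∀ i, i < 0 → S' (f i) ∧ r' (f (i + 1)) (f i) := by
  obtain ⟨u, hu0, hu⟩ := exists_seq_of_step h ha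
  obtain ⟨v, hv0, hv⟩ := exists_seq_of_step h' ha'
  let f : ℤ → T := fun i => if 0 ≤ i then u i.toNat else v (-i).toNat
  have hfu : ∀ n : ℕ, f n = u n := fun n => by simp [f]
  have hfv : ∀ n : ℕ, f (-n) = v n := fun n => by
    rcases Nat.eq_zero_or_pos n with rfl | hn
    · simp [f, hu0, hv0]
    · simp [f, hn.ne']
  refine ⟨f, (hfu 0).trans hu0, fun i hi => ?_, fun i hi => ?_⟩
  · lift i to ℕ using hi
    rw [show (i : ℤ) + 1 = ((i + 1 : ℕ) : ℤ) by push_cast; ring, hfu, hfu]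
    exact hu i
  · obtain ⟨n, rfl⟩ : ∃ n : ℕ, i = -((n + 1 : ℕ) : ℤ) := ⟨(-i - 1).toNat, by omega⟩
    rw [show -((n + 1 : ℕ) : ℤ) + 1 = -(n : ℤ) by push_cast; ring, hfv, hfv]
    exact ⟨(hv (n + 1)).1, (hv n).2⟩

/-- A complete `PC`-resolution is obtained by splicing a projective resolution with iterated
embeddings in `C`-projective modules. -/
theorem gcProjective_of_gcLargest {M : ModuleCat.{u} R} (hM : gcLargest C M) :
    gcProjective C M := by
  have hst := isGCStable_gcLargest C
  let S : ModuleCat.{u} R → Prop := fun M => ∀ Q : ModuleCat.{u} R, Module.Projective R Q →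
    ExtVanishing M (ModuleCat.of R (C ⊗[R] Q))
  obtain ⟨Z, hZ0, hpos, hneg⟩ := exists_int_seq_of_step (S := S) (S' := gcLargest C)
    (r := fun A B => ∃ (F : ModuleCat.{u} R) (f : B →ₗ[R] F) (g : F →ₗ[R] A),
      Module.Projective R F ∧ IsShortExact f g)
    (r' := fun A B => ∃ (E : ModuleCat.{u} R) (f : A →ₗ[R] E) (g : E →ₗ[R] B),
      cProjective C E ∧ IsShortExact f g)
    (fun A hA => by
      obtain ⟨K, F, f, g, hF, h⟩ := exists_projective_presentation A
      exact ⟨K, fun Q hQ => h.extVanishing_left (.of_projective _ _) (hA Q hQ), F, f, g, hF, h⟩)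
    (fun A hA => by
      obtain ⟨E, N, f, g, hE, hN, h⟩ := hst.exists_embedding A hA
      exact ⟨N, hN, E, f, g, hE, h⟩)
    (hst.extVanishing M hM) hM
  have hZ : ∀ i, S (Z i) := fun i => by
    rcases le_or_gt 0 i with hi | hi
    · exact (hpos i hi).1
    · exact hst.extVanishing _ (hneg i hi).1
  have key : ∀ i, ∃ (X : ModuleCat.{u} R) (f : Z (i + 1) →ₗ[R] X) (g : X →ₗ[R] Z i),
      IsShortExact f g ∧ (0 ≤ i → Module.Projective R X) ∧ (i < 0 → cProjective C X) :=
    fun i => by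
    rcases le_or_gt 0 i with hi | hi
    · obtain ⟨-, F, f, g, hF, h⟩ := hpos i hi
      exact ⟨F, f, g, h, fun _ => hF, fun h => absurd hi (by omega)⟩
    · obtain ⟨-, E, f, g, hE, h⟩ := hneg i hi
      exact ⟨E, f, g, h, fun h => absurd hi (by omega), fun _ => hE⟩
  choose X f g hses hproj hcproj using key
  let d : ∀ i, X (i + 1) ⟶ X i := fun i => ModuleCat.ofHom (f i ∘ₗ g (i + 1))
  have hd : ∀ i, d (i + 1) ≫ d i = 0 := fun i => by
    ext x
    exact (congrArg (f i) ((hses (i + 1)).exact.apply_apply_eq_zero _)).trans (map_zero _)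
  let 𝕏 : ChainComplex (ModuleCat.{u} R) ℤ := ChainComplex.of X d hd
  have h𝕏 : ∀ i, 𝕏.d (i + 1) i = d i := fun i => ChainComplex.of_d X d i
  have hrange : ∀ i (x : X i), x ∈ LinearMap.range (d i).hom ↔ x ∈ LinearMap.range (f i) :=
    fun i x => by
      change x ∈ LinearMap.range (f i ∘ₗ g (i + 1)) ↔ _
      rw [LinearMap.range_comp_of_range_eq_top _ (LinearMap.range_eq_top.2 (hses _).surjective)]
  refine ⟨𝕏, ⟨fun i => ?_, hproj, hcproj, fun Q hQ i => ?_⟩, ?_⟩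
  · rw [show i + 2 = i + 1 + 1 by ring, h𝕏, h𝕏]
    intro x
    refine Iff.trans ?_ (((hses (i + 1)).exact x).trans (hrange (i + 1) x).symm)
    exact map_eq_zero_iff (f i) (hses i).injective
  · rw [show i + 2 = i + 1 + 1 by ring, h𝕏, h𝕏]
    intro φ
    constructor
    · intro hφ
      have h1 : (φ : X (i + 1) →ₗ[R] C ⊗[R] Q) ∘ₗ f (i + 1) = 0 := LinearMap.ext fun z => by
        obtain ⟨x, rfl⟩ := (hses (i + 1 + 1)).surjective z
        exact LinearMap.congr_fun hφ x
      obtain ⟨ψ, hψ⟩ := (hses (i + 1)).exists_factor φ h1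
      obtain ⟨χ, hχ⟩ := (hses i).exists_extension (N := ModuleCat.of R (C ⊗[R] Q)) (hZ i Q hQ) ψ
      refine ⟨χ, ?_⟩
      change χ ∘ₗ (f i ∘ₗ g (i + 1)) = φ
      rw [← LinearMap.comp_assoc, hχ, hψ]
    · rintro ⟨χ, rfl⟩
      ext x
      exact (congrArg χ (LinearMap.congr_fun (congrArg ModuleCat.Hom.hom (hd i)) x)).trans
        (map_zero χ)
  · have h1 : 𝕏.d 1 0 = d 0 := h𝕏 0
    rw [h1]
    refine ⟨?_⟩
    have h2 : LinearMap.range (d 0).hom = LinearMap.ker (g 0) := by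
      ext x
      exact (hrange 0 x).trans ((hses 0).exact x).symm
    rw [← hZ0]
    exact ((Submodule.quotEquivOfEq _ _ h2).trans
      ((g 0).quotKerEquivOfSurjective (hses 0).surjective)).symm

theorem IsSemidualizing.gcProjective_of_cProjective (hC : IsSemidualizing C) {L : ModuleCat.{u} R}
    (hL : cProjective C L) : gcProjective C L := by
  refine gcProjective_of_gcLargest ⟨cProjective C, ⟨fun L hL Q hQ => hC.extVanishing hL Q,
    fun L hL => ?_⟩, hL⟩
  refine ⟨L, ModuleCat.of R PUnit, LinearMap.id, 0, hL, cProjective_of_subsingleton _ _,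
    Function.injective_id, fun x => ?_, fun x => ⟨0, Subsingleton.elim _ _⟩⟩
  simp

/-- The class of extensions of members of `gcLargest C` is stable: given `0 ⟶ A ⟶ B ⟶ D ⟶ 0` and
embeddings of `A` and `D` in `E` and `E'`, the map `A ⟶ E` extends to `B` because
`Ext¹(D, E) = 0`, and the resulting embedding of `B` in `E × E'` has a cokernel which is an
extension of the two given cokernels. -/
theorem gcLargest_extension {A B D : ModuleCat.{u} R} {f : A →ₗ[R] B}
    {g : B →ₗ[R] D} (h : IsShortExact f g) (hA : gcLargest C A) (hD : gcLargest C D) :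
    gcLargest C B := by
  have hst := isGCStable_gcLargest C
  refine ⟨fun B => ∃ (A D : ModuleCat.{u} R) (f : A →ₗ[R] B) (g : B →ₗ[R] D),
    IsShortExact f g ∧ gcLargest C A ∧ gcLargest C D, ⟨?_, ?_⟩, A, D, f, g, h, hA, hD⟩
  · rintro B ⟨A, D, f, g, h, hA, hD⟩ Q hQ
    exact h.extVanishing_middle (hst.extVanishing _ hA Q hQ) (hst.extVanishing _ hD Q hQ)
  · rintro B ⟨A, D, f, g, h, hA, hD⟩
    obtain ⟨E, A', a, p, hE, hA', ha⟩ := hst.exists_embedding A hA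
    obtain ⟨E', D', b, q, hE', hD', hb⟩ := hst.exists_embedding D hD
    have hDE : ExtVanishing D E := by
      obtain ⟨Q, hQ, ⟨e⟩⟩ := hE
      exact (hst.extVanishing _ hD Q hQ).of_equiv_right e
    obtain ⟨a', ha'⟩ := h.exists_extension hDE a
    have ha'f : ∀ x, a' (f x) = a x := fun x => LinearMap.congr_fun ha' x
    have hgf : ∀ x, g (f x) = 0 := h.exact.apply_apply_eq_zero
    have hqb : ∀ x, q (b x) = 0 := hb.exact.apply_apply_eq_zero
    let β : B →ₗ[R] E × E' := a'.prod (b ∘ₗ g)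
    have hβ : ∀ x, β x = (a' x, b (g x)) := fun x => rfl
    have hβinj : Function.Injective β := by
      rw [injective_iff_map_eq_zero]
      intro x hx
      rw [hβ, Prod.mk_eq_zero] at hx
      obtain ⟨y, rfl⟩ := (h.exact x).1 (hb.injective (hx.2.trans (map_zero b).symm))
      rw [ha'f] at hx
      rw [ha.injective (hx.1.trans (map_zero a).symm), map_zero]
    let B' := ModuleCat.of R ((E × E') ⧸ LinearMap.range β)
    obtain ⟨s, hs⟩ := ha.exists_factor ((LinearMap.range β).mkQ ∘ₗ LinearMap.inl R E E') (by
      ext x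
      refine (Submodule.Quotient.mk_eq_zero _).2 ⟨f x, ?_⟩
      simp [hβ, ha'f, hgf])
    let t : B' →ₗ[R] D' := (LinearMap.range β).liftQ (q ∘ₗ LinearMap.snd R E E') (by
      rintro _ ⟨x, rfl⟩
      exact hqb (g x))
    have hs' : ∀ x, s (p x) = (LinearMap.range β).mkQ (x, 0) := fun x => LinearMap.congr_fun hs x
    have ht' : ∀ x, t ((LinearMap.range β).mkQ x) = q x.2 := fun x => rfl
    refine ⟨ModuleCat.of R (E × E'), B', β, (LinearMap.range β).mkQ, cProjective_prod hE hE',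
      ⟨A', D', s, t, ⟨?_, ?_, ?_⟩, hA', hD'⟩, ⟨hβinj, ?_, Submodule.mkQ_surjective _⟩⟩
    · rw [injective_iff_map_eq_zero]
      intro z hz
      obtain ⟨x, rfl⟩ := ha.surjective z
      rw [hs'] at hz
      obtain ⟨y, hy⟩ := (Submodule.Quotient.mk_eq_zero _).1 hz
      rw [hβ, Prod.mk.injEq] at hy
      obtain ⟨w, rfl⟩ := (h.exact y).1 (hb.injective (hy.2.trans (map_zero b).symm))
      rw [ha'f] at hy
      rw [← hy.1]
      exact ha.exact.apply_apply_eq_zero w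
    · intro z
      constructor
      · obtain ⟨⟨x, x'⟩, rfl⟩ := Submodule.mkQ_surjective _ z
        intro hz
        obtain ⟨w, hw⟩ := (hb.exact x').1 hz
        obtain ⟨y, rfl⟩ := h.surjective w
        refine ⟨p (x - a' y), ?_⟩
        rw [hs']
        refine (Submodule.Quotient.eq _).2 ⟨-y, ?_⟩
        simp [hβ, hw]
      · rintro ⟨w, rfl⟩
        obtain ⟨x, rfl⟩ := ha.surjective w
        rw [hs', ht']
        exact map_zero q
    · intro z
      obtain ⟨x, rfl⟩ := hb.surjective z
      exact ⟨(LinearMap.range β).mkQ (0, x), ht' _⟩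
    · rw [LinearMap.exact_iff, Submodule.ker_mkQ]

end

/-! ### Existence of strict resolutions -/

section

variable {R : Type u} [CommRing R] {C M : ModuleCat.{u} R}

/-- If `M` is presented by `A` with kernel `N`, and `N` by `B` with kernel `K'`, then
embedding `B` in `E` with cokernel `D` and forming the pushout `G` of `A ⟵ B ⟶ E` presents `M` by
an extension `G` of `D` by `A`, with kernel `K = E / K'`. -/
theorem exists_pushout_presentation {N A K' B E D : ModuleCat.{u} R}
    {ι : N →ₗ[R] A} {p : A →ₗ[R] M} (h₁ : IsShortExact ι p)
    {k : K' →ₗ[R] B} {q : B →ₗ[R] N} (h₂ : IsShortExact k q)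
    {e : B →ₗ[R] E} {π : E →ₗ[R] D} (h₃ : IsShortExact e π) :
    ∃ (G K : ModuleCat.{u} R) (a : A →ₗ[R] G) (d : G →ₗ[R] D) (k' : K' →ₗ[R] E) (r : E →ₗ[R] K)
      (j : K →ₗ[R] G) (γ : G →ₗ[R] M),
      IsShortExact a d ∧ IsShortExact k' r ∧ IsShortExact j γ := by
  have hpι : ∀ x, p (ι x) = 0 := h₁.exact.apply_apply_eq_zero
  have hqk : ∀ x, q (k x) = 0 := h₂.exact.apply_apply_eq_zero
  have hπe : ∀ x, π (e x) = 0 := h₃.exact.apply_apply_eq_zero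
  let β : B →ₗ[R] A × E := (ι ∘ₗ q).prod (-e)
  have hβ : ∀ x, β x = (ι (q x), -e x) := fun x => rfl
  let G := ModuleCat.of R ((A × E) ⧸ LinearMap.range β)
  let mk : A × E →ₗ[R] G := (LinearMap.range β).mkQ
  have hmk : ∀ x, mk x = 0 ↔ ∃ y, β y = x := fun x => Submodule.Quotient.mk_eq_zero _
  have hmks : Function.Surjective mk := Submodule.mkQ_surjective _
  have hmke : ∀ x, mk (0, e x) = mk (ι (q x), 0) := fun x => by
    rw [← sub_eq_zero, ← map_sub, hmk]
    exact ⟨-x, by simp [hβ]⟩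
  have hmkadd : ∀ x y, mk (x, y) = mk (x, 0) + mk (0, y) := fun x y => by
    rw [← map_add, Prod.mk_add_mk, add_zero, zero_add]
  let d : G →ₗ[R] D := (LinearMap.range β).liftQ (π ∘ₗ LinearMap.snd R A E) (by
    rintro _ ⟨x, rfl⟩
    simp [hβ, hπe])
  let γ : G →ₗ[R] M := (LinearMap.range β).liftQ (p ∘ₗ LinearMap.fst R A E) (by
    rintro _ ⟨x, rfl⟩
    simp [hβ, hpι])
  have hd : ∀ x, d (mk x) = π x.2 := fun x => rfl
  have hγ : ∀ x, γ (mk x) = p x.1 := fun x => rfl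
  have hγs : Function.Surjective γ := fun m => by
    obtain ⟨x, rfl⟩ := h₁.surjective m
    exact ⟨mk (x, 0), hγ _⟩
  let r : E →ₗ[R] LinearMap.ker γ := (mk ∘ₗ LinearMap.inr R A E).codRestrict (LinearMap.ker γ)
    fun x => (hγ (0, x)).trans (map_zero p)
  have hr : ∀ x, (r x : G) = mk (0, x) := fun x => rfl
  refine ⟨G, ModuleCat.of R (LinearMap.ker γ), mk ∘ₗ LinearMap.inl R A E, d, e ∘ₗ k, r,
    (LinearMap.ker γ).subtype, γ, ⟨?_, ?_, ?_⟩, ⟨h₃.injective.comp h₂.injective, ?_, ?_⟩,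
    isShortExact_ker_subtype hγs⟩
  · rw [injective_iff_map_eq_zero]
    intro x hx
    obtain ⟨y, hy⟩ := (hmk (x, 0)).1 hx
    rw [hβ, Prod.mk.injEq, neg_eq_zero] at hy
    rw [h₃.injective (hy.2.trans (map_zero e).symm), map_zero, map_zero] at hy
    exact hy.1.symm
  · intro z
    constructor
    · obtain ⟨⟨x, y⟩, rfl⟩ := hmks z
      intro hz
      obtain ⟨w, rfl⟩ := (h₃.exact y).1 hz
      refine ⟨x + ι (q w), ?_⟩
      rw [hmkadd, hmke, ← map_add, Prod.mk_add_mk, add_zero]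
      rfl
    · rintro ⟨x, rfl⟩
      exact (hd (x, 0)).trans (map_zero π)
  · intro z
    obtain ⟨x, rfl⟩ := h₃.surjective z
    exact ⟨mk (0, x), hd _⟩
  · intro z
    constructor
    · intro hz
      obtain ⟨y, hy⟩ := (hmk (0, z)).1 (by rw [← hr, hz]; rfl)
      rw [hβ, Prod.mk.injEq] at hy
      obtain ⟨w, hw⟩ := (h₂.exact y).1 (h₁.injective (hy.1.trans (map_zero ι).symm))
      refine ⟨-w, ?_⟩
      simp [hw, hy.2]
    · rintro ⟨w, rfl⟩
      refine Subtype.ext ?_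
      rw [hr]
      refine (hmke (k w)).trans ?_
      rw [hqk, map_zero]
      exact map_zero mk
  · rintro ⟨z, hz⟩
    obtain ⟨⟨x, y⟩, rfl⟩ := hmks z
    obtain ⟨w, rfl⟩ := (h₁.exact x).1 hz
    obtain ⟨v, rfl⟩ := h₂.surjective w
    refine ⟨e v + y, Subtype.ext ?_⟩
    change mk (0, e v + y) = mk (ι (q v), y)
    rw [hmkadd (ι (q v)) y, ← hmke, ← map_add, Prod.mk_add_mk, add_zero]

/-- A `G_C`-projective resolution concentrated in degrees `≤ n` can be replaced by a strict one,
by induction on `n`: a strict resolution of the first syzygy is prolonged using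
`exists_pushout_presentation`, with its degree zero term embedded in a `C`-projective module. -/
theorem exists_isStrict (hC : IsSemidualizing C) (n : ℕ) :
    ∀ {M : ModuleCat.{u} R} (X : ClassResolution (gcProjective C) M),
      (∀ i, n < i → Subsingleton (X.complex.X i)) →
      ∃ Y : ClassResolution (gcProjective C) M, Y.IsStrict ∧
        ∀ i, n < i → Subsingleton (Y.complex.X i) := by
  induction n with
  | zero =>
    intro M X hX
    exact ⟨X, ⟨⟨0, hX⟩, fun i hi => by
      have := hX i hi
      exact cProjective_of_subsingleton _ _⟩, hX⟩
  | succ n ih =>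
    intro M X hX
    obtain ⟨Y, hY, hYn⟩ := ih (X.ker (𝒴 := gcProjective C) fun i => X.mem (i + 1))
      fun i hi => hX (i + 1) (by omega)
    obtain ⟨E, D, e, π, hE, hD, h₃⟩ := (isGCStable_gcLargest C).exists_embedding _
      (gcLargest_of_gcProjective hC (Y.mem 0))
    obtain ⟨G, K, a, d, k', r, j, γ, hG, hK, hM⟩ := exists_pushout_presentation
      (N := ModuleCat.of R (LinearMap.ker X.aug.hom))
      (K' := ModuleCat.of R (LinearMap.ker Y.aug.hom))
      (isShortExact_ker_subtype X.surjective_aug) (isShortExact_ker_subtype Y.surjective_aug) h₃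
    have hGC : gcProjective C G := gcProjective_of_gcLargest
      (gcLargest_extension hG (gcLargest_of_gcProjective hC (X.mem 0)) hD)
    have hYC : ∀ i, cProjective C (Y.complex.X (i + 1)) := fun i =>
      hY.cProjective (i + 1) (by omega)
    let V : ClassResolution (cProjective C) K := (Y.ker hYC).splice (Y.ker hYC).mem hE hK
    let W : ClassResolution (gcProjective C) M :=
      V.splice (fun i => hC.gcProjective_of_cProjective (V.mem i)) hGC hM
    have hW : ∀ i, n + 1 < i → Subsingleton (W.complex.X i) := fun i hi => by
      obtain ⟨i, rfl⟩ : ∃ l, i = l + 2 := ⟨i - 2, by omega⟩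
      exact hYn (i + 1) (by omega)
    refine ⟨W, ⟨⟨n + 1, hW⟩, fun i hi => ?_⟩, hW⟩
    obtain ⟨i, rfl⟩ : ∃ l, i = l + 1 := ⟨i - 1, by omega⟩
    exact V.mem i

/-! ### Strict resolutions are proper -/

theorem isShortExact_ker_codRestrict {A B D : Type u} [AddCommGroup A] [AddCommGroup B]
    [AddCommGroup D] [Module R A] [Module R B] [Module R D] {f : A →ₗ[R] B} {g : B →ₗ[R] D}
    (h : Function.Exact f g) :
    IsShortExact (LinearMap.ker f).subtype
      (f.codRestrict (LinearMap.ker g) h.apply_apply_eq_zero) where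
  injective := Subtype.val_injective
  exact := fun x => Subtype.ext_iff.trans (LinearMap.exact_subtype_ker_map f x)
  surjective := by
    rintro ⟨y, hy⟩
    obtain ⟨x, hx⟩ := (h y).1 hy
    exact ⟨x, Subtype.ext hx⟩

theorem extVanishing_of_cProjective {H L : ModuleCat.{u} R} (hH : gcLargest C H)
    (hL : cProjective C L) : ExtVanishing H L := by
  obtain ⟨Q, hQ, ⟨e⟩⟩ := hL
  exact ((isGCStable_gcLargest C).extVanishing _ hH Q hQ).of_equiv_right e

/-- The kernels in a strict resolution are finitely resolved by `C`-projective modules, on which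
`Ext^i(H, -)` vanishes. -/
theorem ClassResolution.IsStrict.extVanishing_ker {X : ClassResolution (gcProjective C) M}
    (hX : X.IsStrict) {H : ModuleCat.{u} R} (hH : gcLargest C H) (i : ℕ) :
    ExtVanishing H (ModuleCat.of R (LinearMap.ker (X.complex.d (i + 1) i).hom)) := by
  obtain ⟨n, hn⟩ := hX.bounded
  -- Descending induction on `i`, phrased as induction on a bound for `n - i`.
  suffices ∀ k i, n ≤ i + k →
      ExtVanishing H (ModuleCat.of R (LinearMap.ker (X.complex.d (i + 1) i).hom)) from
    this n i (by omega)
  intro k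
  induction k with
  | zero =>
    intro i hi
    have := hn (i + 1) (by omega)
    have : Subsingleton (ModuleCat.of R (LinearMap.ker (X.complex.d (i + 1) i).hom)) :=
      inferInstanceAs (Subsingleton (LinearMap.ker (X.complex.d (i + 1) i).hom))
    exact .of_subsingleton_right _ _
  | succ k ih =>
    intro i hi
    exact (isShortExact_ker_codRestrict (X.exact_succ i)).extVanishing_right_of_covariant
      (A := ModuleCat.of R (LinearMap.ker (X.complex.d (i + 2) (i + 1)).hom))
      (D := ModuleCat.of R (LinearMap.ker (X.complex.d (i + 1) i).hom)) (ih (i + 1) (by omega))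
      (extVanishing_of_cProjective hH (hX.cProjective (i + 2) (by omega)))

theorem ClassResolution.IsStrict.extVanishing_ker_aug {X : ClassResolution (gcProjective C) M}
    (hX : X.IsStrict) {H : ModuleCat.{u} R} (hH : gcLargest C H) :
    ExtVanishing H (ModuleCat.of R (LinearMap.ker X.aug.hom)) :=
  (isShortExact_ker_codRestrict X.exact_zero).extVanishing_right_of_covariant
    (A := ModuleCat.of R (LinearMap.ker (X.complex.d 1 0).hom))
    (D := ModuleCat.of R (LinearMap.ker X.aug.hom)) (hX.extVanishing_ker hH 0)
    (extVanishing_of_cProjective hH (hX.cProjective 1 le_rfl))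

/-- If every map from `H` to `Ker g` lifts along `f`, then `Hom(H, -)` preserves exactness. -/
theorem exact_postcomp {A B D H : Type u} [AddCommGroup A] [AddCommGroup B] [AddCommGroup D]
    [AddCommGroup H] [Module R A] [Module R B] [Module R D] [Module R H] {f : A →ₗ[R] B}
    {g : B →ₗ[R] D} (hgf : ∀ x, g (f x) = 0)
    (hl : ∀ b : H →ₗ[R] LinearMap.ker g, ∃ a : H →ₗ[R] A, f.codRestrict _ hgf ∘ₗ a = b) :
    Function.Exact (fun a : H →ₗ[R] A => f ∘ₗ a) (fun b : H →ₗ[R] B => g ∘ₗ b) := by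
  intro b
  constructor
  · intro hb
    obtain ⟨a, ha⟩ := hl (b.codRestrict _ fun x => LinearMap.congr_fun hb x)
    exact ⟨a, LinearMap.ext fun x => congrArg Subtype.val (LinearMap.congr_fun ha x)⟩
  · rintro ⟨a, rfl⟩
    exact LinearMap.ext fun x => hgf (a x)

/-- The obstructions to lifting along a strict resolution lie in `Ext¹(H, -)` of its kernels. -/
theorem ClassResolution.IsStrict.isProper (hC : IsSemidualizing C)
    {X : ClassResolution (gcProjective C) M} (hX : X.IsStrict) : X.IsProper := by
  intro H hH
  have hH := gcLargest_of_gcProjective hC hH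
  refine ⟨?_, ?_, fun i => ?_⟩
  · exact (isShortExact_ker_subtype X.surjective_aug).exists_lift
      (A := ModuleCat.of R (LinearMap.ker X.aug.hom)) (hX.extVanishing_ker_aug hH)
  · exact exact_postcomp X.exact_zero.apply_apply_eq_zero
      ((isShortExact_ker_codRestrict X.exact_zero).exists_lift
        (A := ModuleCat.of R (LinearMap.ker (X.complex.d 1 0).hom))
        (D := ModuleCat.of R (LinearMap.ker X.aug.hom)) (hX.extVanishing_ker hH 0))
  · exact exact_postcomp (X.exact_succ i).apply_apply_eq_zero
      ((isShortExact_ker_codRestrict (X.exact_succ i)).exists_lift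
        (A := ModuleCat.of R (LinearMap.ker (X.complex.d (i + 2) (i + 1)).hom))
        (D := ModuleCat.of R (LinearMap.ker (X.complex.d (i + 1) i).hom))
        (hX.extVanishing_ker hH (i + 1)))

theorem ClassResolution.IsStrict.isGCApproximation {X : ClassResolution (gcProjective C) M}
    (hX : X.IsStrict) :
    IsGCApproximation C (ModuleCat.ofHom (LinearMap.ker X.aug.hom).subtype) X.aug where
  injective := Subtype.val_injective
  exact := LinearMap.exact_subtype_ker_map X.aug.hom
  surjective := X.surjective_aug
  gcProjective := X.mem 0
  finite_dim := by
    obtain ⟨n, hn⟩ := hX.bounded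
    refine (classProjDim_le (X.ker fun i => hX.cProjective (i + 1) (by omega))).trans_lt ?_
    exact ClassResolution.length_lt_top _ (n := n) fun i hi => hn (i + 1) (by omega)

end

theorem theorem3p6 {R : Type u} [CommRing R] (C : ModuleCat.{u} R) (hC : IsSemidualizing C)
    (M : ModuleCat.{u} R) (hM : classProjDim (gcProjective C) M < ⊤) :
    ∃ X : ClassResolution (gcProjective C) M,
      X.IsStrict ∧
      X.length = classProjDim (gcProjective C) M ∧
      IsGCApproximation C (ModuleCat.ofHom (LinearMap.ker X.aug.hom).subtype) X.aug ∧
      X.IsProper := by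
  suffices ∃ X : ClassResolution (gcProjective C) M, X.IsStrict ∧
      X.length ≤ classProjDim (gcProjective C) M by
    obtain ⟨X, hX, hXl⟩ := this
    exact ⟨X, hX, hXl.antisymm (classProjDim_le X), hX.isGCApproximation, hX.isProper hC⟩
  obtain ⟨X, hXl⟩ := exists_length_eq_classProjDim hM
  rw [← hXl] at hM ⊢
  by_cases hzero : ∀ i, Subsingleton (X.complex.X i)
  · exact ⟨X, ⟨⟨0, fun i _ => hzero i⟩, fun i _ => by
      have := hzero i
      exact cProjective_of_subsingleton _ _⟩, le_rfl⟩
  -- The length of a nonzero bounded resolution is a natural number.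
  obtain ⟨m, hm⟩ := not_forall.1 hzero
  have hm := X.le_length m (not_subsingleton_iff_nontrivial.1 hm)
  obtain ⟨l, hl⟩ := WithBot.ne_bot_iff_exists.1 (WithBot.bot_lt_coe _ |>.trans_le hm).ne'
  rw [← hl, ← WithBot.coe_top, WithBot.coe_lt_coe] at hM
  lift l to ℕ using hM.ne
  obtain ⟨Y, hY, hYl⟩ := exists_isStrict hC l X fun i hi => by
    by_contra hni
    have h := X.le_length i (not_subsingleton_iff_nontrivial.1 hni)
    rw [← hl, WithBot.coe_le_coe, Nat.cast_le] at h
    omega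
  refine ⟨Y, hY, ?_⟩
  rw [← hl]
  refine Y.length_le fun i hi => ?_
  have : i ≤ l := by
    by_contra hil
    exact not_subsingleton_iff_nontrivial.2 hi (hYl i (by omega))
  exact_mod_cast this
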